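/- Let $F\colon \mathsf{Set}\to\mathsf{Set}$ be a functor that preserves inverse images, i.e. $F$ maps every pullback square along a monomorphism (the pullback of a monomorphism $s\colon S\rightarrowtail B$ along an arbitrary map $f\colon A\to B$) to a pullback square. Then for every $F$-coalgebra $\alpha\colon A\to FA$ the following three properties are equivalent. (1) $(A,\alpha)$ is well-founded: $\mathrm{id}_A$ is the only fixed point of the next time operator $\bigcirc\colon \mathrm{Sub}(A)\to\mathrm{Sub}(A)$, which assigns to each subobject $s\colon S\rightarrowtail A$ the inverse image $\bigcirc s$ of $Fs\colon FS\rightarrowtail FA$ under $\alpha$. (2) $(A,\alpha)$ is parametrically recursive: for every set $X$ and every map $e\colon FX\times A\to X$ there is a unique map $e^\dagger\colon A\to X$ such that $e^\dagger = e\cdot(Fe^\dagger\times \mathrm{id}_A)\cdot\langle\alpha,\mathrm{id}_A\rangle$. (3) $(A,\alpha)$ is recursive: for every algebra $x\colon FX\to X$ there is a unique map $h\colon A\to X$ such that $h = x\cdot Fh\cdot\alpha$. -/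

import Mathlib

open CategoryTheory CategoryTheory.Limits

universe v u

namespace CoalgRec

variable {C : Type u} [Category.{v} C]

/-- An endofunctor preserves inverse images if it sends every pullback of a monomorphism `s`
along an arbitrary morphism `f` to a pullback square. -/
class PreservesInverseImages (F : C ⥤ C) : Prop where
  map_isPullback : ∀ {T A S B : C} {t : T ⟶ A} {g : T ⟶ S} {f : A ⟶ B} {s : S ⟶ B},
    Mono s → IsPullback t g f s → IsPullback (F.map t) (F.map g) (F.map f) (F.map s)

/-- A functor preserving inverse images preserves monomorphisms, because `s` is a monomorphism
iff the square formed by two identities and two copies of `s` is a pullback. -/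
instance preservesMonomorphisms_of_preservesInverseImages (F : C ⥤ C)
    [PreservesInverseImages F] : F.PreservesMonomorphisms where
  preserves {X Y} f hf := by
    have h : IsPullback (𝟙 X) (𝟙 X) f f := IsKernelPair.id_of_mono f
    have h2 := PreservesInverseImages.map_isPullback (F := F) hf h
    simp only [F.map_id] at h2
    exact IsKernelPair.mono_of_isIso_fst h2

/-- The next time operator of a coalgebra `α : A ⟶ F A`: it sends a subobject `s : S ⟶ A` to the
inverse image of `F s : F S ⟶ F A` under `α`. -/
noncomputable def nextTime [HasPullbacks C] {F : C ⥤ C} [F.PreservesMonomorphisms]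
    (A : Endofunctor.Coalgebra F) (s : Subobject A.V) : Subobject A.V :=
  (Subobject.pullback A.str).obj (Subobject.mk (F.map s.arrow))

/-- A coalgebra is well-founded if the full subobject (given by the identity of the carrier) is
the only fixed point of its next time operator. -/
def IsWellFounded [HasPullbacks C] {F : C ⥤ C} [F.PreservesMonomorphisms]
    (A : Endofunctor.Coalgebra F) : Prop :=
  ∀ s : Subobject A.V, nextTime A s = s ↔ s = ⊤

/-- A coalgebra is recursive if it has a unique coalgebra-to-algebra morphism into every
algebra. -/
def IsRecursive {F : C ⥤ C} (A : Endofunctor.Coalgebra F) : Prop :=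
  ∀ X : Endofunctor.Algebra F, ∃! h : A.V ⟶ X.a, h = A.str ≫ F.map h ≫ X.str

/-- A coalgebra `(A, α)` is parametrically recursive if for every morphism `e : F X ⨯ A ⟶ X` there
is a unique `d : A ⟶ X` with `d = e ∘ (F d × A) ∘ ⟨α, A⟩`. -/
def IsParametricallyRecursive [HasBinaryProducts C] {F : C ⥤ C}
    (A : Endofunctor.Coalgebra F) : Prop :=
  ∀ (X : C) (e : F.obj X ⨯ A.V ⟶ X),
    ∃! d : A.V ⟶ X, d = prod.lift A.str (𝟙 A.V) ≫ prod.map (F.map d) (𝟙 A.V) ≫ e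

end CoalgRec

namespace CoalgRec

/-! Identify subobjects with subsets, so that ○S = α⁻¹(`lift F S`). Well-foundedness becomes an
induction principle: by Knaster–Tarski, ○S ⊆ S forces S = A. Induction on the agreement set of two
solutions gives uniqueness. For existence, partial solutions on sets S ⊆ ○S agree on overlaps,
because `lift` preserves intersections (`lift_inter`); they glue to one on the union U of their
domains. One more recursion step extends it to ○U, so ○U ⊆ U and U = A. Conversely, a fixed point of
○ has a characteristic map that is a coalgebra-to-algebra morphism into an algebra of truth values
(`preimage_lift`); uniqueness of such morphisms identifies every fixed point with A. -/

/-- The image of the map `F S ⟶ F A` induced by the inclusion of a subset `S` of `A`. -/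
def lift (F : Type u ⥤ Type u) {A : Type u} (S : Set A) : Set (F.obj A) :=
  Set.range (F.map (↾(Subtype.val : S → A)))

section Lift

variable (F : Type u ⥤ Type u) {A B : Type u}

theorem exists_comp_eq_of_range_subset {X Y : Type u} {f : X ⟶ A} {g : Y ⟶ A}
    (h : Set.range f ⊆ Set.range g) : ∃ k : X ⟶ Y, k ≫ g = f := by
  choose k hk using fun x => h (Set.mem_range_self x)
  exact ⟨↾k, by ext x; exact hk x⟩

theorem range_subset_of_comp_eq {X Y : Type u} {f : X ⟶ A} {g : Y ⟶ A} {k : X ⟶ Y}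
    (h : k ≫ g = f) : Set.range f ⊆ Set.range g := by
  rintro _ ⟨x, rfl⟩
  exact ⟨k x, ConcreteCategory.congr_hom h x⟩

/-- By choice `f` factors through `g`, and any functor preserves the factorization; neither map need
be injective. -/
theorem range_map_mono {X Y : Type u} (f : X ⟶ A) (g : Y ⟶ A)
    (h : Set.range f ⊆ Set.range g) : Set.range (F.map f) ⊆ Set.range (F.map g) := by
  obtain ⟨k, rfl⟩ := exists_comp_eq_of_range_subset h
  exact range_subset_of_comp_eq (F.map_comp k g).symm

theorem range_ofHom_val (S : Set A) : Set.range (↾(Subtype.val : S → A)) = S :=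
  Subtype.range_val

theorem range_map_eq_lift {X : Type u} (f : X ⟶ A) :
    Set.range (F.map f) = lift F (Set.range f) :=
  (range_map_mono F _ _ (range_ofHom_val _).ge).antisymm
    (range_map_mono F _ _ (range_ofHom_val _).le)

theorem lift_univ : lift F (Set.univ : Set A) = Set.univ := by
  have h : Set.range (𝟙 A) = Set.univ := Set.range_id
  rw [← h, ← range_map_eq_lift, F.map_id]
  exact Set.range_id

theorem lift_mono {S T : Set A} (h : S ⊆ T) : lift F S ⊆ lift F T :=
  range_map_mono F _ _ (by simpa using h)

theorem map_eq_of_mem_lift {S : Set A} {f g : A ⟶ B} (h : ∀ a ∈ S, f a = g a)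
    {t : F.obj A} (ht : t ∈ lift F S) : F.map f t = F.map g t := by
  have hfg : ↾(Subtype.val : S → A) ≫ f = ↾(Subtype.val : S → A) ≫ g := by
    ext x
    exact h x x.2
  obtain ⟨t, rfl⟩ := ht
  rw [← Functor.map_comp_apply, ← Functor.map_comp_apply, hfg]

variable [PreservesInverseImages F]

/-- This is the form in which preservation of inverse images is used below: the first leg of a
pullback square has as its range the preimage of the other map's range. -/
theorem preimage_lift (f : A ⟶ B) (S : Set B) :
    F.map f ⁻¹' lift F S = lift F (f ⁻¹' S) := by
  have h : IsPullback (↾(Subtype.val : f ⁻¹' S → A))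
      (↾(fun a : f ⁻¹' S => (⟨f a, a.2⟩ : S))) f (↾(Subtype.val : S → B)) := by
    rw [Types.isPullback_iff]
    refine ⟨rfl, fun x y hxy => Subtype.ext hxy.1, fun a b hab => ?_⟩
    have hb : f a = b.1 := hab
    exact ⟨⟨a, by simp [hb]⟩, rfl, Subtype.ext hb⟩
  exact (Types.range_fst_of_isPullback
    (PreservesInverseImages.map_isPullback (subtype_val_mono S) h)).symm

/-- An intersection is an inverse image along the inclusion of `T`, so `preimage_lift` applies. -/
theorem lift_inter (S T : Set A) : lift F (S ∩ T) = lift F S ∩ lift F T := by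
  refine (Set.subset_inter (lift_mono F Set.inter_subset_left)
    (lift_mono F Set.inter_subset_right)).antisymm ?_
  rintro _ ⟨hS, ⟨t, rfl⟩⟩
  have ht : t ∈ lift F (↾(Subtype.val : T → A) ⁻¹' S) := by
    rw [← preimage_lift]
    exact hS
  obtain ⟨r, rfl⟩ := ht
  rw [← Functor.map_comp_apply]
  refine range_map_mono F (↾Subtype.val ≫ ↾Subtype.val) (↾Subtype.val) ?_ ⟨r, rfl⟩
  rintro _ ⟨x, rfl⟩
  exact ⟨⟨x.1.1, x.2, x.1.2⟩, rfl⟩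

end Lift

section WellFounded

variable {F : Type u ⥤ Type u} (A : Endofunctor.Coalgebra F)

theorem range_arrow_injective {A : Type u} :
    Function.Injective fun s : Subobject A => Set.range s.arrow := by
  have hle : ∀ s t : Subobject A, Set.range s.arrow ⊆ Set.range t.arrow → s ≤ t := by
    intro s t h
    obtain ⟨k, hk⟩ := exists_comp_eq_of_range_subset h
    exact Subobject.le_of_comm k hk
  exact fun s t h => (hle s t h.le).antisymm (hle t s h.ge)

theorem range_mk_arrow {A B : Type u} (f : B ⟶ A) [Mono f] :
    Set.range (Subobject.mk f).arrow = Set.range f :=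
  (range_subset_of_comp_eq (Subobject.underlyingIso_hom_comp_eq_mk f)).antisymm
    (range_subset_of_comp_eq (Subobject.underlyingIso_arrow f))

theorem range_arrow_surjective {A : Type u} :
    Function.Surjective fun s : Subobject A => Set.range s.arrow := fun S =>
  have := subtype_val_mono S
  ⟨Subobject.mk (↾Subtype.val), (range_mk_arrow _).trans (range_ofHom_val S)⟩

theorem range_top_arrow (A : Type u) : Set.range (⊤ : Subobject A).arrow = Set.univ :=
  (range_mk_arrow (𝟙 A)).trans Set.range_id

theorem range_nextTime_arrow [F.PreservesMonomorphisms] (s : Subobject A.V) :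
    Set.range (nextTime A s).arrow = A.str ⁻¹' lift F (Set.range s.arrow) := by
  have h := Types.range_snd_of_isPullback
    (Subobject.isPullback A.str (Subobject.mk (F.map s.arrow)))
  rw [range_mk_arrow, range_map_eq_lift] at h
  exact h

/-- Well-foundedness of a coalgebra in `Type u` in terms of subsets of its carrier. -/
theorem isWellFounded_iff [F.PreservesMonomorphisms] :
    IsWellFounded A ↔ ∀ S : Set A.V, A.str ⁻¹' lift F S = S ↔ S = Set.univ := by
  rw [IsWellFounded, range_arrow_surjective.forall]
  refine forall_congr' fun s => ?_
  rw [← range_arrow_injective.eq_iff, ← range_arrow_injective.eq_iff, range_nextTime_arrow,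
    range_top_arrow]

/-- Induction along a well-founded coalgebra. -/
theorem IsWellFounded.eq_univ [F.PreservesMonomorphisms] {A : Endofunctor.Coalgebra F}
    (hA : IsWellFounded A) {S : Set A.V} (hS : A.str ⁻¹' lift F S ⊆ S) : S = Set.univ := by
  let Φ : Set A.V →o Set A.V :=
    ⟨fun T => A.str ⁻¹' lift F T, fun _ _ h => Set.preimage_mono (lift_mono F h)⟩
  -- The least fixed point is everything, and it lies below every `S` with ○S ⊆ S.
  have h : Φ.lfp = Set.univ := ((isWellFounded_iff A).1 hA _).1 Φ.map_lfp
  exact Set.univ_subset_iff.1 (h ▸ Φ.lfp_le hS)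

end WellFounded

section Recursion

variable {F : Type u ⥤ Type u} {A : Endofunctor.Coalgebra F} {X : Type u}
  (e : F.obj X → A.V → X)

/-- A map satisfying the recursion equation `d a = e (F d (α a)) a` on a subset `S` that is
contained in `○ S`. -/
structure IsPartialSolution (S : Set A.V) (d : A.V ⟶ X) : Prop where
  mem_lift : ∀ a ∈ S, A.str a ∈ lift F S
  eq : ∀ a ∈ S, d a = e (F.map d (A.str a)) a

theorem IsWellFounded.solution_unique [F.PreservesMonomorphisms] (hA : IsWellFounded A)
    {d d' : A.V ⟶ X} (hd : ∀ a, d a = e (F.map d (A.str a)) a)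
    (hd' : ∀ a, d' a = e (F.map d' (A.str a)) a) : d = d' := by
  have h : {a | d a = d' a} = Set.univ := by
    refine hA.eq_univ fun a ha => ?_
    rw [Set.mem_ofPred_eq, hd, hd', map_eq_of_mem_lift F (fun _ hb => hb) ha]
  ext a
  exact h.symm.subset (Set.mem_univ a)

variable [PreservesInverseImages F]

theorem IsPartialSolution.agree (hA : IsWellFounded A) {S T : Set A.V} {c d : A.V ⟶ X}
    (hc : IsPartialSolution e S c) (hd : IsPartialSolution e T d) {a : A.V} (haS : a ∈ S)
    (haT : a ∈ T) : c a = d a := by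
  have h : {a | a ∈ S ∩ T → c a = d a} = Set.univ := by
    refine hA.eq_univ fun a ha haST => ?_
    -- The induction hypothesis concerns only the implication set; intersecting with both domains
    -- gives a set on which `c` and `d` really agree.
    have hmem : A.str a ∈ lift F ({a | a ∈ S ∩ T → c a = d a} ∩ (S ∩ T)) := by
      rw [lift_inter, lift_inter]
      exact ⟨ha, hc.mem_lift a haST.1, hd.mem_lift a haST.2⟩
    have hcd : ∀ b ∈ {a | a ∈ S ∩ T → c a = d a} ∩ (S ∩ T), c b = d b :=
      fun b hb => hb.1 hb.2
    rw [hc.eq a haST.1, hd.eq a haST.2, map_eq_of_mem_lift F hcd hmem]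
  exact h.symm.subset (Set.mem_univ a) ⟨haS, haT⟩

theorem IsWellFounded.exists_solution_of_nonempty [Nonempty X] (hA : IsWellFounded A) :
    ∃ d : A.V ⟶ X, ∀ a, d a = e (F.map d (A.str a)) a := by
  classical
  let U : Set A.V := {a | ∃ S d, IsPartialSolution e S d ∧ a ∈ S}
  have hU : ∀ a : A.V, ∃ x : X, ∀ S d, IsPartialSolution e S d → a ∈ S → d a = x := by
    intro a
    by_cases ha : a ∈ U
    · obtain ⟨S, d, hd, haS⟩ := ha
      exact ⟨d a, fun T c hc haT => hc.agree e hA hd haT haS⟩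
    -- The value outside `U` is irrelevant: for `a ∈ U`, the recursion equation depends only on
    -- values on `U`.
    · exact ⟨Classical.arbitrary X, fun S d hd haS => (ha ⟨S, d, hd, haS⟩).elim⟩
  choose c hc using hU
  have hcU : IsPartialSolution e U (↾c) := by
    refine ⟨?_, ?_⟩ <;> rintro a ⟨S, d, hd, haS⟩
    · exact lift_mono F (fun b hb => Set.mem_ofPred_eq.mpr ⟨S, d, hd, hb⟩) (hd.mem_lift a haS)
    · have hdc : ∀ b ∈ S, d b = (↾c) b := fun b hb => hc b S d hd hb
      rw [← map_eq_of_mem_lift F hdc (hd.mem_lift a haS), ← hd.eq a haS]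
      exact (hc a S d hd haS).symm
  -- One unfolding of the recursion agrees with `c` on `U` and solves the equation on all of ○U.
  let d : A.V ⟶ X := ↾fun a => e (F.map (↾c) (A.str a)) a
  have hcd : ∀ a ∈ U, (↾c) a = d a := hcU.eq
  have hd : IsPartialSolution e (A.str ⁻¹' lift F U) d :=
    ⟨fun a ha => lift_mono F hcU.mem_lift ha, fun a ha => by
      rw [← map_eq_of_mem_lift F hcd ha]
      rfl⟩
  have h : U = Set.univ := hA.eq_univ fun a ha => Set.mem_ofPred_eq.mpr ⟨_, d, hd, ha⟩
  exact ⟨↾c, fun a => hcU.eq a (h.symm.subset (Set.mem_univ a))⟩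

theorem IsWellFounded.exists_solution (hA : IsWellFounded A) :
    ∃ d : A.V ⟶ X, ∀ a, d a = e (F.map d (A.str a)) a := by
  rcases isEmpty_or_nonempty X with hX | hX
  -- If `X` is empty, so is the carrier: an element of ○∅ would come from F∅, hence yield an element
  -- of F X and, through `e`, one of `X`.
  · have h : (∅ : Set A.V) = Set.univ := by
      refine hA.eq_univ ?_
      rintro a ⟨t, -⟩
      exact hX.elim (e (F.map (↾fun x : (∅ : Set A.V) => x.2.elim) t) a)
    have hV : ∀ a : A.V, False := fun a => h.symm.subset (Set.mem_univ a)
    exact ⟨↾fun a => (hV a).elim, fun a => (hV a).elim⟩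
  · exact hA.exists_solution_of_nonempty e

end Recursion

variable {F : Type u ⥤ Type u} {A : Endofunctor.Coalgebra F}

theorem prod_lift_apply {X Y Z : Type u} (f : X ⟶ Y) (g : X ⟶ Z) (x : X) :
    prod.lift f g x = (Types.binaryProductIso Y Z).inv (f x, g x) := by
  have h : prod.lift f g = ↾(fun x => (f x, g x)) ≫ (Types.binaryProductIso Y Z).inv := by
    ext1
    · rw [prod.lift_fst, Category.assoc, Types.binaryProductIso_inv_comp_fst]
      rfl
    · rw [prod.lift_snd, Category.assoc, Types.binaryProductIso_inv_comp_snd]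
      rfl
  rw [h]
  rfl

theorem IsWellFounded.isParametricallyRecursive [PreservesInverseImages F]
    (hA : IsWellFounded A) : IsParametricallyRecursive A := by
  intro X e
  let e' : F.obj X → A.V → X := fun t a => e ((Types.binaryProductIso _ _).inv (t, a))
  have key : ∀ d : A.V ⟶ X,
      d = prod.lift A.str (𝟙 A.V) ≫ prod.map (F.map d) (𝟙 A.V) ≫ e ↔
        ∀ a, d a = e' (F.map d (A.str a)) a := by
    intro d
    rw [prod.lift_map_assoc, ConcreteCategory.hom_ext_iff]
    refine forall_congr' fun a => ?_
    rw [types_comp_apply, prod_lift_apply]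
    rfl
  simp only [key]
  obtain ⟨d, hd⟩ := hA.exists_solution e'
  exact ⟨d, hd, fun d' hd' => hA.solution_unique e' hd' hd⟩

/-- An algebra is a parametrized one that ignores its parameter. -/
theorem IsParametricallyRecursive.isRecursive (hA : IsParametricallyRecursive A) :
    IsRecursive A := by
  intro X
  simpa only [prod.lift_map_assoc, prod.lift_fst_assoc, Category.assoc] using
    hA X.a (prod.fst ≫ X.str)

theorem IsRecursive.isWellFounded [PreservesInverseImages F] (hA : IsRecursive A) :
    IsWellFounded A := by
  rw [isWellFounded_iff]
  let T : Set (ULift.{u} Prop) := {p | p.down}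
  -- The structure map is the characteristic function of `lift F T`, so that composing it with
  -- `F.map (χ S)` classifies `lift F S`.
  let Ω : Endofunctor.Algebra F := ⟨ULift.{u} Prop, ↾fun t => ⟨t ∈ lift F T⟩⟩
  let χ (S : Set A.V) : A.V ⟶ Ω.a := ↾fun a => ⟨a ∈ S⟩
  have key : ∀ S : Set A.V, A.str ⁻¹' lift F S = S → χ S = A.str ≫ F.map (χ S) ≫ Ω.str := by
    intro S hS
    have h : F.map (χ S) ⁻¹' lift F T = lift F S := preimage_lift F (χ S) T
    ext a
    have h' := Set.ext_iff.1 hS a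
    rw [← h] at h'
    exact h'.symm
  have huniv : A.str ⁻¹' lift F Set.univ = Set.univ := by
    rw [lift_univ, Set.preimage_univ]
  refine fun S => ⟨fun hS => ?_, fun hS => hS ▸ huniv⟩
  have h := (hA Ω).unique (key S hS) (key _ huniv)
  ext a
  have ha := congrArg ULift.down (ConcreteCategory.congr_hom h a)
  exact iff_of_eq ha

end CoalgRec

theorem corollaryC (F : Type u ⥤ Type u) [CoalgRec.PreservesInverseImages F]
    (A : CategoryTheory.Endofunctor.Coalgebra F) :
    [CoalgRec.IsWellFounded A, CoalgRec.IsParametricallyRecursive A,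
      CoalgRec.IsRecursive A].TFAE := by
  tfae_have 1 → 2 := fun h => h.isParametricallyRecursive
  tfae_have 2 → 3 := fun h => h.isRecursive
  tfae_have 3 → 1 := fun h => h.isWellFounded
  tfae_finish
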